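/- Let $H$ and $U$ be Hilbert spaces (both real or both complex), let $A:D(A)\subset H\to H$ be a densely defined closed operator such that $A$ and its adjoint $A^*$ are dissipative and closed, let $B\in\mathcal L(U,H)$, and let $0<d_0\le d_1$. For $c\in\mathbb R$ write $A_c:=A-cBB^*$, with domain $D(A)$. Suppose that the origin of $\dot v=A_{d_0}v$ is globally exponentially stable in $H$, that is, $A_{d_0}$ generates a strongly continuous semigroup $(e^{tA_{d_0}})_{t\ge0}$ and there are $K_0,\beta_0>0$ with $\|e^{tA_{d_0}}v_0\|\le K_0e^{-\beta_0t}\|v_0\|$ for all $v_0\in H$ and $t\ge0$. Then there exist constants $K,\beta>0$ such that for every measurable $d:[0,\infty)\to\mathbb R$ with $d_0\le d(t)\le d_1$ for almost every $t\ge0$, and for every $v_0\in H$, the system $$\dot v=(A-d(t)BB^*)v,\qquad v(0)=v_0,$$ has a mild solution, i.e. a continuous function $v:[0,\infty)\to H$ with $$v(t)=e^{tA}v_0-\int_0^t d(s)\,e^{(t-s)A}BB^*v(s)\,ds\qquad(t\ge0),$$ where $(e^{tA})_{t\ge0}$ is the strongly continuous semigroup generated by $A$, and every such solution satisfies $$\|v(t)\|\le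 Ke^{-\beta t}\|v_0\|\qquad(t\ge0).$$ (In particular the solution is unique.) -/

import Mathlib

open MeasureTheory Set Filter Topology

noncomputable section

/-- An unbounded operator `T` on a Hilbert space is dissipative: `Re ⟪T x, x⟫ ≤ 0` on its domain. -/
def IsDissipativeOp {𝕜 H : Type*} [RCLike 𝕜] [NormedAddCommGroup H] [InnerProductSpace 𝕜 H]
    (T : H →ₗ.[𝕜] H) : Prop :=
  ∀ x : T.domain, RCLike.re (inner 𝕜 (T x) (x : H)) ≤ 0

/-- A strongly continuous semigroup `(S t)_{t ≥ 0}` of bounded operators.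
Only the values `S t` with `t ≥ 0` matter. -/
structure IsC0Semigroup {𝕜 H : Type*} [RCLike 𝕜] [NormedAddCommGroup H] [InnerProductSpace 𝕜 H]
    (S : ℝ → H →L[𝕜] H) : Prop where
  zero : S 0 = ContinuousLinearMap.id 𝕜 H
  add : ∀ s t : ℝ, 0 ≤ s → 0 ≤ t → S (s + t) = (S s).comp (S t)
  cont : ∀ x : H, ContinuousOn (fun t => S t x) (Ici 0)

/-- `T`, with exactly its domain, is the infinitesimal generator of `(S t)_{t ≥ 0}`:
`x ∈ D(T)` and `T x = y` if and only if `(S h x - x) / h → y` as `h → 0+`. -/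
def IsInfinitesimalGenerator {𝕜 H : Type*} [RCLike 𝕜] [NormedAddCommGroup H]
    [InnerProductSpace 𝕜 H] (T : H →ₗ.[𝕜] H) (S : ℝ → H →L[𝕜] H) : Prop :=
  ∀ x y : H, (x, y) ∈ T.graph ↔
    Tendsto (fun h : ℝ => ((h⁻¹ : ℝ) : 𝕜) • (S h x - x)) (𝓝[>] 0) (𝓝 y)

/-- `T` generates a strongly continuous semigroup that is exponentially stable, that is, the
origin of `v' = T v` is globally exponentially stable. -/
def GeneratesExpStableSemigroup {𝕜 H : Type*} [RCLike 𝕜] [NormedAddCommGroup H]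
    [InnerProductSpace 𝕜 H] (T : H →ₗ.[𝕜] H) : Prop :=
  ∃ S : ℝ → H →L[𝕜] H, IsC0Semigroup S ∧ IsInfinitesimalGenerator T S ∧
    ∃ K > (0 : ℝ), ∃ β > (0 : ℝ), ∀ x : H, ∀ t : ℝ, 0 ≤ t →
      ‖S t x‖ ≤ K * Real.exp (-β * t) * ‖x‖

/-- The bounded operator `B B⋆` on `H`. -/
def dampingOp {𝕜 H U : Type*} [RCLike 𝕜]
    [NormedAddCommGroup H] [InnerProductSpace 𝕜 H] [CompleteSpace H]
    [NormedAddCommGroup U] [InnerProductSpace 𝕜 U] [CompleteSpace U]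
    (B : U →L[𝕜] H) : H →L[𝕜] H :=
  B.comp (ContinuousLinearMap.adjoint B)

/-- The operator `A - c B B⋆` with domain `D(A)`. -/
def feedbackOp {𝕜 H U : Type*} [RCLike 𝕜]
    [NormedAddCommGroup H] [InnerProductSpace 𝕜 H] [CompleteSpace H]
    [NormedAddCommGroup U] [InnerProductSpace 𝕜 U] [CompleteSpace U]
    (A : H →ₗ.[𝕜] H) (B : U →L[𝕜] H) (c : ℝ) : H →ₗ.[𝕜] H where
  domain := A.domain
  toFun := A.toFun - (c : 𝕜) • (dampingOp B : H →ₗ[𝕜] H).comp A.domain.subtype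

/-- `v` is a mild solution on `[τ, ∞)` of `v' = (A - d(t) B B⋆) v`, `v(τ) = vτ`: it is continuous
and satisfies Duhamel's formula, where `S t = e^{tA}` is the semigroup generated by `A`
(a semigroup is determined by its generator). -/
def IsMildSolution {𝕜 H U : Type*} [RCLike 𝕜]
    [NormedAddCommGroup H] [InnerProductSpace 𝕜 H] [CompleteSpace H]
    [NormedSpace ℝ H] [IsScalarTower ℝ 𝕜 H]
    [NormedAddCommGroup U] [InnerProductSpace 𝕜 U] [CompleteSpace U]
    (A : H →ₗ.[𝕜] H) (B : U →L[𝕜] H) (d : ℝ → ℝ) (τ : ℝ) (vτ : H) (v : ℝ → H) : Prop :=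
  ∃ S : ℝ → H →L[𝕜] H, IsC0Semigroup S ∧ IsInfinitesimalGenerator A S ∧
    ContinuousOn v (Ici τ) ∧
    ∀ t : ℝ, τ ≤ t →
      v t = S (t - τ) vτ - ∫ s in τ..t, d s • S (t - s) (dampingOp B (v s))

end

/-! Let `T` be the semigroup of `A - d₀BB⋆` and `S` that of `A`; both are contractive by
dissipativity. Two estimates are played against each other. The energy inequality `‖v t‖² +
2d₀∫‖B⋆v‖² ≤ ‖x‖²` (`IsDuhamelSolution.energy_le`) says that the observed damping is paid for by a
loss of norm. Writing `v` by variation of constants around `T`, with forcing `(d₀ - d)BB⋆v`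
(`IsDuhamelSolution.change_semigroup`), shows that `v` deviates from `T` only as far as `B⋆v` is
large (`IsDuhamelSolution.norm_sq_le`). At a time `τ` with `‖T τ‖ ≤ 1/2`, either much norm has been
lost to damping or `v` is close to the decaying `T τ x`. Hence `‖v τ‖ ≤ ρ‖x‖` with `ρ < 1`
independent of `d` (`exists_uniform_contraction`), and iteration over time shifts gives exponential
decay.

Mild solutions need not be differentiable. Derivatives are replaced by the expansion `v (t + h) = S
h (v t) + (∫ c) • C (v t) + o(h)` as `h → 0+`, and differential inequalities by inequalities up to
`o(h)`. This works for measurable coefficients and all initial states, without approximation by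
regular solutions. The semigroup `S` itself is built from `T` by adding back the bounded term
`d₀BB⋆`. -/

/-! ### Grönwall inequalities with `o(h)` errors. -/

section Gronwall

open Asymptotics

/-- A Grönwall inequality in which the growth condition holds up to a little-o of the step. -/
theorem le_mul_exp_of_forall_isLittleO {φ : ℝ → ℝ} {K : ℝ} (hφ : Continuous φ)
    (h : ∀ t, 0 ≤ t → ∃ r : ℝ → ℝ, r =o[𝓝[>] 0] (fun h : ℝ => h) ∧
      ∀ᶠ h in 𝓝[>] (0 : ℝ), φ (t + h) ≤ φ t + K * φ t * h + r h)
    {a b : ℝ} (ha : 0 ≤ a) (hab : a ≤ b) : φ b ≤ φ a * Real.exp (K * (b - a)) := by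
  have key := le_gronwallBound_of_liminf_deriv_right_le (f := φ) (f' := fun t => K * φ t)
    (δ := φ a) (K := K) (ε := 0) (a := a) (b := b) hφ.continuousOn ?_ le_rfl (by simp) b ⟨hab, le_rfl⟩
  · rwa [gronwallBound_ε0] at key
  intro t ht ρ hρ
  obtain ⟨r, hr, hle⟩ := h t (ha.trans ht.1)
  apply Eventually.frequently
  have hev : ∀ᶠ h in 𝓝[>] (0 : ℝ), h⁻¹ * (φ (t + h) - φ t) < ρ := by
    -- Half of the gap `ρ - K * φ t` goes to the error term, which leaves a strict inequality.
    have h2 := hr.def (c := (ρ - K * φ t) / 2) (by linarith)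
    filter_upwards [hle, h2, self_mem_nhdsWithin] with h h1 h2 h3
    have h3 : 0 < h := h3
    rw [Real.norm_eq_abs, Real.norm_eq_abs, abs_of_pos h3] at h2
    have := le_abs_self (r h)
    rw [inv_mul_lt_iff₀ h3]
    nlinarith
  have hmap : Tendsto (fun z => z - t) (𝓝[>] t) (𝓝[>] 0) := by
    refine tendsto_nhdsWithin_iff.2 ⟨?_, ?_⟩
    · have : Tendsto (fun z : ℝ => z - t) (𝓝 t) (𝓝 (t - t)) :=
        (continuous_id.sub continuous_const).tendsto t
      rw [sub_self] at this
      exact this.mono_left nhdsWithin_le_nhds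
    · filter_upwards [self_mem_nhdsWithin] with z hz
      exact sub_pos.2 (mem_Ioi.1 hz)
  filter_upwards [hmap.eventually hev] with z hz
  simpa [slope, smul_eq_mul] using hz

/-- A continuous function which increases at most by a little-o of the step is antitone. -/
theorem le_of_forall_isLittleO {φ : ℝ → ℝ} (hφ : Continuous φ)
    (h : ∀ t, 0 ≤ t → ∃ r : ℝ → ℝ, r =o[𝓝[>] 0] (fun h : ℝ => h) ∧
      ∀ᶠ h in 𝓝[>] (0 : ℝ), φ (t + h) ≤ φ t + r h)
    {a b : ℝ} (ha : 0 ≤ a) (hab : a ≤ b) : φ b ≤ φ a := by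
  simpa using le_mul_exp_of_forall_isLittleO (K := 0) hφ (by simpa using h) ha hab

end Gronwall

/-! ### Contraction semigroups and their Duhamel integrals. -/

section Semigroup

open Asymptotics

variable {𝕜 H : Type*} [RCLike 𝕜] [NormedAddCommGroup H] [InnerProductSpace 𝕜 H]

/-- A strongly continuous contraction semigroup, continuous on all of `ℝ` although only
the values `S t` with `t ≥ 0` matter. -/
structure IsContractionSemigroup (S : ℝ → H →L[𝕜] H) : Prop where
  zero : S 0 = ContinuousLinearMap.id 𝕜 H
  add : ∀ s t : ℝ, 0 ≤ s → 0 ≤ t → S (s + t) = (S s).comp (S t)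
  norm_le : ∀ t x, ‖S t x‖ ≤ ‖x‖
  cont : ∀ x : H, Continuous (fun t => S t x)

/-- The uniform bound `‖S t‖ ≤ 1` upgrades strong continuity to joint continuity, so `S (t - s) (g
s)` is continuous in all variables. -/
theorem IsContractionSemigroup.continuous_uncurry {S : ℝ → H →L[𝕜] H}
    (hS : IsContractionSemigroup S) : Continuous (fun p : ℝ × H => S p.1 p.2) := by
  rw [continuous_iff_continuousAt]
  rintro ⟨t, x⟩
  rw [ContinuousAt, tendsto_iff_norm_sub_tendsto_zero]
  have h0 : Tendsto (fun p : ℝ × H => ‖p.2 - x‖ + ‖S p.1 x - S t x‖) (𝓝 (t, x)) (𝓝 0) := by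
    have h1 : Continuous (fun p : ℝ × H => ‖p.2 - x‖ + ‖S p.1 x - S t x‖) :=
      (continuous_snd.sub continuous_const).norm.add
        (((hS.cont x).comp continuous_fst).sub continuous_const).norm
    simpa using h1.tendsto (t, x)
  refine squeeze_zero (fun _ => norm_nonneg _) (fun p => ?_) h0
  calc ‖S p.1 p.2 - S t x‖ = ‖S p.1 (p.2 - x) + (S p.1 x - S t x)‖ := by
        rw [map_sub]; congr 1; abel
    _ ≤ _ := (norm_add_le _ _).trans (by gcongr; exact hS.norm_le _ _)

theorem IsContractionSemigroup.continuous_apply {S : ℝ → H →L[𝕜] H}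
    (hS : IsContractionSemigroup S) {X : Type*} [TopologicalSpace X] {f : X → ℝ} {g : X → H}
    (hf : Continuous f) (hg : Continuous g) : Continuous (fun p => S (f p) (g p)) :=
  hS.continuous_uncurry.comp (hf.prodMk hg)

variable [NormedSpace ℝ H]

theorem intervalIntegrable_smul_of_bounded {c : ℝ → ℝ} (hc : Measurable c) {M : ℝ}
    (hM : ∀ s, |c s| ≤ M) {g : ℝ → H} (hg : Continuous g) (a b : ℝ) :
    IntervalIntegrable (fun s => c s • g s) volume a b := by
  have h1 : IntervalIntegrable (fun s => M * ‖g s‖) volume a b :=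
    (continuous_const.mul hg.norm).intervalIntegrable a b
  refine h1.mono_fun' (hc.aestronglyMeasurable.smul hg.aestronglyMeasurable) ?_
  refine Eventually.of_forall fun s => ?_
  simp only [norm_smul]
  exact mul_le_mul_of_nonneg_right (hM s) (norm_nonneg _)

/-- Over a short interval the Duhamel integral is the integral of the coefficient times the
value of the forcing at the left end, up to a little-o of the length. -/
theorem IsContractionSemigroup.integral_sub_isLittleO {S : ℝ → H →L[𝕜] H}
    (hS : IsContractionSemigroup S) {c : ℝ → ℝ} (hc : Measurable c) {M : ℝ}
    (hM : ∀ s, |c s| ≤ M) {g : ℝ → H} (hg : Continuous g) (t : ℝ) [CompleteSpace H] :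
    (fun h : ℝ => (∫ s in t..t + h, c s • S (t + h - s) (g s)) - (∫ s in t..t + h, c s) • g t)
      =o[𝓝[>] 0] (fun h : ℝ => h) := by
  have hM0 : 0 ≤ M := (abs_nonneg _).trans (hM 0)
  rw [isLittleO_iff]
  intro ε hε
  have hF : Continuous (fun p : ℝ × ℝ => S p.1 (g p.2)) :=
    hS.continuous_apply continuous_fst (hg.comp continuous_snd)
  -- `M + 1` rather than `M`, since `M` may vanish.
  have hε' : 0 < ε / (M + 1) := by positivity
  obtain ⟨δ, hδ, hδF⟩ := Metric.continuousAt_iff.1 (hF.continuousAt (x := (0, t))) _ hε'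
  filter_upwards [self_mem_nhdsWithin, nhdsWithin_le_nhds (Iio_mem_nhds hδ)] with h h1 h2
  have h1 : 0 < h := h1
  have h2 : h < δ := h2
  have hint1 := intervalIntegrable_smul_of_bounded hc hM
    (hS.continuous_apply (f := fun s => t + h - s) (g := g) (by fun_prop) hg) t (t + h)
  have hint2 := intervalIntegrable_smul_of_bounded hc hM (g := fun _ => g t)
    continuous_const t (t + h)
  rw [← intervalIntegral.integral_smul_const, ← intervalIntegral.integral_sub hint1 hint2]
  have hb : ∀ s ∈ uIoc t (t + h), ‖c s • S (t + h - s) (g s) - c s • g t‖ ≤ ε := by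
    intro s hs
    rw [uIoc_of_le (by linarith)] at hs
    have hd : dist (t + h - s, s) (0, t) < δ := by
      rw [Prod.dist_eq, max_lt_iff]
      constructor
      · rw [Real.dist_eq, sub_zero, abs_lt]; constructor <;> linarith [hs.1, hs.2]
      · rw [Real.dist_eq, abs_lt]; constructor <;> linarith [hs.1, hs.2]
    have := hδF hd
    simp only [hS.zero, ContinuousLinearMap.id_apply, dist_eq_norm] at this
    rw [← smul_sub, norm_smul, Real.norm_eq_abs]
    calc |c s| * ‖S (t + h - s) (g s) - g t‖ ≤ M * (ε / (M + 1)) := by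
          gcongr
          exact hM s
      _ ≤ (M + 1) * (ε / (M + 1)) := by gcongr; linarith
      _ = ε := by field_simp
  have := intervalIntegral.norm_integral_le_of_norm_le_const hb
  simpa using this

theorem IsContractionSemigroup.continuous_integral {S : ℝ → H →L[𝕜] H}
    (hS : IsContractionSemigroup S) {c : ℝ → ℝ} (hc : Measurable c) {M : ℝ}
    (hM : ∀ s, |c s| ≤ M) {g : ℝ → H} (hg : Continuous g) [CompleteSpace H] :
    Continuous (fun t => ∫ s in (0 : ℝ)..t, c s • S (t - s) (g s)) := by
  rw [continuous_iff_continuousAt]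
  intro t
  -- The window `(-|t| - 1, |t| + 1)` has both `0` and `t` in its interior. The parameter and the
  -- upper limit vary independently and are then set equal.
  have key := intervalIntegral.continuousAt_parametric_primitive_of_dominated (μ := volume)
    (F := fun t s => c s • S (t - s) (g s)) (fun s => M * ‖g s‖) (-|t| - 1) (|t| + 1)
    (a₀ := 0) (b₀ := t) (x₀ := t) ?_ ?_ ?_ ?_ ?_ ?_ (by simp)
  · exact key.comp (f := fun t : ℝ => (t, t)) (by fun_prop)
  · intro r
    exact hc.aestronglyMeasurable.smul
      (hS.continuous_apply (f := fun s => r - s) (by fun_prop) hg).aestronglyMeasurable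
  · refine Eventually.of_forall fun r => Eventually.of_forall fun s => ?_
    rw [norm_smul]
    exact mul_le_mul (hM s) (hS.norm_le _ _) (norm_nonneg _) ((abs_nonneg _).trans (hM 0))
  · exact (continuous_const.mul hg.norm).intervalIntegrable _ _
  · refine Eventually.of_forall fun s => Continuous.continuousAt ?_
    exact (hS.continuous_apply (f := fun r => r - s) (g := fun _ => g s)
      (by fun_prop) continuous_const).const_smul (c s)
  · constructor <;> linarith [abs_nonneg t]
  · constructor <;> linarith [neg_abs_le t, le_abs_self t]

/-- On `[0, t]` the semigroup law pulls `S h` out of the integral; this is what makes restarting at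
time `t` possible. -/
theorem IsContractionSemigroup.integral_add {S : ℝ → H →L[𝕜] H} [IsScalarTower ℝ 𝕜 H]
    (hS : IsContractionSemigroup S) {c : ℝ → ℝ} (hc : Measurable c) {M : ℝ}
    (hM : ∀ s, |c s| ≤ M) {g : ℝ → H} (hg : Continuous g) [CompleteSpace H] {t h : ℝ}
    (ht : 0 ≤ t) (hh : 0 ≤ h) :
    ∫ s in (0 : ℝ)..t + h, c s • S (t + h - s) (g s) =
      S h (∫ s in (0 : ℝ)..t, c s • S (t - s) (g s)) +
        ∫ s in t..t + h, c s • S (t + h - s) (g s) := by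
  have hint : ∀ r a b, IntervalIntegrable (fun s => c s • S (r - s) (g s)) volume a b :=
    fun r a b => intervalIntegrable_smul_of_bounded hc hM
      (hS.continuous_apply (f := fun s => r - s) (g := g) (by fun_prop) hg) a b
  rw [← intervalIntegral.integral_add_adjacent_intervals (hint (t + h) 0 t) (hint (t + h) t (t + h)),
    ← ContinuousLinearMap.intervalIntegral_comp_comm _ (hint t 0 t)]
  congr 1
  refine intervalIntegral.integral_congr fun s hs => ?_
  rw [uIcc_of_le ht] at hs
  have h1 : t + h - s = h + (t - s) := by ring
  simp only [RCLike.real_smul_eq_coe_smul (K := 𝕜), map_smul]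
  rw [h1, hS.add h (t - s) hh (by linarith [hs.2])]
  rfl

end Semigroup

/-! ### Duhamel equations: first-order expansion, uniqueness, existence. -/

section Duhamel

open Asymptotics

variable {𝕜 H : Type*} [RCLike 𝕜] [NormedAddCommGroup H] [InnerProductSpace 𝕜 H]
  [NormedSpace ℝ H]

/-- `v` solves `v t = S t x + ∫ s in 0..t, c s • S (t - s) (C (v s))` for `t ≥ 0`. -/
structure IsDuhamelSolution (S : ℝ → H →L[𝕜] H) (C : H →L[𝕜] H) (c : ℝ → ℝ) (x : H)
    (v : ℝ → H) : Prop where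
  cont : Continuous v
  eq : ∀ t : ℝ, 0 ≤ t → v t = S t x + ∫ s in (0 : ℝ)..t, c s • S (t - s) (C (v s))

theorem IsDuhamelSolution.map_zero {S : ℝ → H →L[𝕜] H} {C : H →L[𝕜] H} {c : ℝ → ℝ} {x : H}
    {v : ℝ → H} (hv : IsDuhamelSolution S C c x v) (hS : IsContractionSemigroup S) : v 0 = x := by
  simpa [hS.zero] using hv.eq 0 le_rfl

theorem abs_integral_le_of_bounded {c : ℝ → ℝ} {M : ℝ} (hM : ∀ s, |c s| ≤ M) (t : ℝ) {h : ℝ}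
    (hh : 0 ≤ h) : |∫ s in t..t + h, c s| ≤ M * h := by
  have := intervalIntegral.norm_integral_le_of_norm_le_const (a := t) (b := t + h) (f := c)
    (C := M) (fun s _ => hM s)
  simpa [abs_of_nonneg hh] using this

variable {S : ℝ → H →L[𝕜] H} {C : H →L[𝕜] H} {c : ℝ → ℝ} {M : ℝ} {x y : H} {v w : ℝ → H}

theorem IsDuhamelSolution.intervalIntegrable (hv : IsDuhamelSolution S C c x v)
    (hS : IsContractionSemigroup S) (hc : Measurable c) (hM : ∀ s, |c s| ≤ M) (t a b : ℝ) :
    IntervalIntegrable (fun s => c s • S (t - s) (C (v s))) volume a b :=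
  intervalIntegrable_smul_of_bounded hc hM
    (hS.continuous_apply (f := fun s => t - s) (g := fun s => C (v s)) (by fun_prop)
      (C.continuous.comp hv.cont)) a b

/-- The factor `1 / l` gained in the weight `exp (l * t)` makes the fixed-point map contractive on
the whole half-line at once. -/
theorem norm_duhamelIntegral_le (hS : IsContractionSemigroup S)
    (hM : ∀ s, |c s| ≤ M) {g : ℝ → H} {R l : ℝ} (hl : 0 < l)
    (hg : ∀ s, 0 ≤ s → ‖g s‖ ≤ R * Real.exp (l * s)) {t : ℝ} (ht : 0 ≤ t) :
    ‖∫ s in (0 : ℝ)..t, c s • S (t - s) (g s)‖ ≤ M * R / l * Real.exp (l * t) := by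
  have hM0 : 0 ≤ M := (abs_nonneg _).trans (hM 0)
  have hR : 0 ≤ R := by simpa using (norm_nonneg _).trans (hg 0 le_rfl)
  have h1 : ‖∫ s in (0 : ℝ)..t, c s • S (t - s) (g s)‖ ≤
      ∫ s in (0 : ℝ)..t, M * (R * Real.exp (l * s)) := by
    refine intervalIntegral.norm_integral_le_of_norm_le ht ?_ ?_
    · refine Eventually.of_forall fun s hs => ?_
      rw [norm_smul]
      exact mul_le_mul (hM s) ((hS.norm_le _ _).trans (hg s hs.1.le)) (norm_nonneg _) hM0
    · exact (by fun_prop : Continuous fun s => M * (R * Real.exp (l * s))).intervalIntegrable _ _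
  refine h1.trans ?_
  have h2 : ∫ s in (0 : ℝ)..t, M * (R * Real.exp (l * s)) =
      M * R / l * Real.exp (l * t) - M * R / l * Real.exp (l * 0) := by
    refine intervalIntegral.integral_eq_sub_of_hasDerivAt (f := fun s => M * R / l * Real.exp (l * s))
      (fun s _ => ?_) ?_
    · have := (((hasDerivAt_id s).const_mul l).exp).const_mul (M * R / l)
      refine this.congr_deriv ?_
      simp only [id]
      field_simp
    · exact (by fun_prop : Continuous fun s => M * (R * Real.exp (l * s))).intervalIntegrable _ _
  rw [h2]
  have : 0 ≤ M * R / l * Real.exp (l * 0) := by positivity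
  linarith

theorem IsDuhamelSolution.add (hv : IsDuhamelSolution S C c x v)
    (hw : IsDuhamelSolution S C c y w) (hS : IsContractionSemigroup S) (hc : Measurable c)
    (hM : ∀ s, |c s| ≤ M) : IsDuhamelSolution S C c (x + y) (fun t => v t + w t) where
  cont := hv.cont.add hw.cont
  eq t ht := by
    simp only [map_add, smul_add]
    rw [intervalIntegral.integral_add (hv.intervalIntegrable hS hc hM t 0 t)
      (hw.intervalIntegrable hS hc hM t 0 t), hv.eq t ht, hw.eq t ht]
    abel

theorem IsDuhamelSolution.congr (hv : IsDuhamelSolution S C c x v) (hw : Continuous w)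
    (h : ∀ t, 0 ≤ t → w t = v t) : IsDuhamelSolution S C c x w where
  cont := hw
  eq t ht := by
    rw [h t ht, hv.eq t ht]
    congr 1
    refine intervalIntegral.integral_congr fun s hs => ?_
    rw [uIcc_of_le ht] at hs
    simp only [h s hs.1]

variable [IsScalarTower ℝ 𝕜 H]

theorem IsDuhamelSolution.const_smul (hv : IsDuhamelSolution S C c x v) (r : 𝕜) :
    IsDuhamelSolution S C c (r • x) (fun t => r • v t) where
  cont := hv.cont.const_smul r
  eq t ht := by
    simp only [map_smul, RCLike.real_smul_eq_coe_smul (K := 𝕜), smul_comm _ r]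
    rw [intervalIntegral.integral_smul, hv.eq t ht, smul_add]
    simp only [RCLike.real_smul_eq_coe_smul (K := 𝕜)]

variable [CompleteSpace H]

theorem IsDuhamelSolution.apply_add (hv : IsDuhamelSolution S C c x v)
    (hS : IsContractionSemigroup S) (hc : Measurable c) (hM : ∀ s, |c s| ≤ M) {t h : ℝ}
    (ht : 0 ≤ t) (hh : 0 ≤ h) :
    v (t + h) = S h (v t) + ∫ s in t..t + h, c s • S (t + h - s) (C (v s)) := by
  rw [hv.eq (t + h) (by positivity), hv.eq t ht,
    hS.integral_add hc hM (g := fun s => C (v s)) (C.continuous.comp hv.cont) ht hh, add_comm t h, hS.add h t hh ht,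
    map_add, ← add_assoc]
  rfl

/-- This expansion stands in for the differential equation; `v t` need not lie in the domain of the
generator. -/
theorem IsDuhamelSolution.isLittleO (hv : IsDuhamelSolution S C c x v)
    (hS : IsContractionSemigroup S) (hc : Measurable c) (hM : ∀ s, |c s| ≤ M) {t : ℝ}
    (ht : 0 ≤ t) :
    (fun h => v (t + h) - S h (v t) - (∫ s in t..t + h, c s) • C (v t))
      =o[𝓝[>] 0] (fun h : ℝ => h) := by
  refine (hS.integral_sub_isLittleO hc hM (C.continuous.comp hv.cont) t).congr' ?_ .rfl
  filter_upwards [self_mem_nhdsWithin] with h hh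
  rw [hv.apply_add hS hc hM ht (le_of_lt (mem_Ioi.1 hh))]
  simp

theorem IsDuhamelSolution.shift (hv : IsDuhamelSolution S C c x v)
    (hS : IsContractionSemigroup S) (hc : Measurable c) (hM : ∀ s, |c s| ≤ M) {τ : ℝ}
    (hτ : 0 ≤ τ) :
    IsDuhamelSolution S C (fun s => c (s + τ)) (v τ) (fun s => v (s + τ)) where
  cont := hv.cont.comp (by fun_prop)
  eq t ht := by
    rw [add_comm t τ, hv.apply_add hS hc hM hτ ht]
    congr 1
    have := intervalIntegral.integral_comp_add_right (a := 0) (b := t)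
      (fun s => c s • S (τ + t - s) (C (v s))) τ
    rw [zero_add, add_comm t τ] at this
    rw [← this]
    refine intervalIntegral.integral_congr fun s _ => ?_
    congr 3
    ring

/-- Grönwall applied to `‖v t‖`: `S h` does not increase the norm and the forcing adds at most `M *
‖C‖ * ‖v t‖ * h`, up to `o(h)`. It yields uniqueness and the boundedness of the perturbed semigroup.
-/
theorem IsDuhamelSolution.norm_le (hv : IsDuhamelSolution S C c x v)
    (hS : IsContractionSemigroup S) (hc : Measurable c) (hM : ∀ s, |c s| ≤ M) {t : ℝ}
    (ht : 0 ≤ t) : ‖v t‖ ≤ ‖x‖ * Real.exp (M * ‖C‖ * t) := by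
  have key := le_mul_exp_of_forall_isLittleO (φ := fun t => ‖v t‖) (K := M * ‖C‖)
    hv.cont.norm ?_ le_rfl ht
  · simpa [hv.map_zero hS] using key
  intro t ht
  refine ⟨_, (hv.isLittleO hS hc hM ht).norm_left, ?_⟩
  filter_upwards [self_mem_nhdsWithin] with h hh
  have hh : 0 < h := hh
  have h1 : ‖(∫ s in t..t + h, c s) • C (v t)‖ ≤ M * ‖C‖ * ‖v t‖ * h := by
    rw [norm_smul, Real.norm_eq_abs]
    calc _ ≤ (M * h) * (‖C‖ * ‖v t‖) := by
          gcongr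
          · exact mul_nonneg ((abs_nonneg _).trans (hM 0)) hh.le
          · exact abs_integral_le_of_bounded hM t hh.le
          · exact C.le_opNorm _
      _ = _ := by ring
  have h2 := hS.norm_le h (v t)
  have h3 : v (t + h) = S h (v t) + (∫ s in t..t + h, c s) • C (v t) +
      (v (t + h) - S h (v t) - (∫ s in t..t + h, c s) • C (v t)) := by abel
  calc ‖v (t + h)‖ ≤ _ := (congrArg norm h3).le.trans (norm_add₃_le)
    _ ≤ _ := by gcongr

theorem IsDuhamelSolution.unique (hv : IsDuhamelSolution S C c x v)
    (hw : IsDuhamelSolution S C c x w) (hS : IsContractionSemigroup S) (hc : Measurable c)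
    (hM : ∀ s, |c s| ≤ M) {t : ℝ} (ht : 0 ≤ t) : v t = w t := by
  have h := (hv.add (hw.const_smul (-1)) hS hc hM).norm_le hS hc hM ht
  simpa [← sub_eq_add_neg, sub_eq_zero] using h

/-- Existence of Duhamel solutions, by a fixed point in an exponentially weighted space. -/
theorem exists_isDuhamelSolution (hS : IsContractionSemigroup S) (C : H →L[𝕜] H)
    (hc : Measurable c) (hM : ∀ s, |c s| ≤ M) (x : H) :
    ∃ v, IsDuhamelSolution S C c x v := by
  have hM0 : 0 ≤ M := (abs_nonneg _).trans (hM 0)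
  -- Chosen so that `M * ‖C‖ / l ≤ 1 / 2`; the `+ 1` keeps `l` positive.
  set l : ℝ := 2 * (M * ‖C‖) + 1 with hl
  have hl0 : 0 < l := by positivity
  let g : BoundedContinuousFunction ℝ H → ℝ → H := fun w s => Real.exp (l * s) • C (w s)
  have hg : ∀ w, Continuous (g w) := fun w =>
    (by fun_prop : Continuous fun s => Real.exp (l * s)).smul (C.continuous.comp w.continuous)
  have hgn : ∀ w s, ‖g w s‖ ≤ ‖C‖ * ‖w‖ * Real.exp (l * s) := by
    intro w s
    simp only [g, norm_smul, Real.norm_eq_abs, Real.abs_exp]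
    rw [mul_comm]
    gcongr
    exact (C.le_opNorm _).trans (by gcongr; exact w.norm_coe_le_norm s)
  let I : BoundedContinuousFunction ℝ H → ℝ → H := fun w t =>
    ∫ s in (0 : ℝ)..t, c s • S (t - s) (g w s)
  have hI : ∀ w, Continuous (I w) := fun w => hS.continuous_integral hc hM (hg w)
  have hIn : ∀ w t, 0 ≤ t → ‖I w t‖ ≤ M * (‖C‖ * ‖w‖) / l * Real.exp (l * t) := fun w t ht =>
    norm_duhamelIntegral_le hS hM hl0 (fun s _ => hgn w s) ht
  -- The unknown is `w t = exp (-l t) v t`, frozen for `t < 0` so that it is bounded on all of `ℝ`.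
  let F : BoundedContinuousFunction ℝ H → ℝ → H := fun w t =>
    Real.exp (-(l * max t 0)) • (S (max t 0) x + I w (max t 0))
  have hF : ∀ w, Continuous (F w) := fun w =>
    (by fun_prop : Continuous fun t => Real.exp (-(l * max t 0))).smul
      (((hS.cont x).add (hI w)).comp (by fun_prop : Continuous fun t : ℝ => max t 0))
  have hexp : ∀ t, Real.exp (-(l * t)) * Real.exp (l * t) = 1 := fun t => by
    rw [← Real.exp_add]; simp
  have hFn : ∀ w t, ‖F w t‖ ≤ ‖x‖ + M * (‖C‖ * ‖w‖) / l := by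
    intro w t
    have ht : 0 ≤ max t 0 := le_max_right _ _
    simp only [F, norm_smul, Real.norm_eq_abs, Real.abs_exp]
    have h1 : ‖S (max t 0) x + I w (max t 0)‖ ≤
        ‖x‖ + M * (‖C‖ * ‖w‖) / l * Real.exp (l * max t 0) :=
      (norm_add_le _ _).trans (add_le_add (hS.norm_le _ _) (hIn w _ ht))
    have h2 : Real.exp (-(l * max t 0)) ≤ 1 :=
      Real.exp_le_one_iff.2 (neg_nonpos.2 (by positivity))
    calc _ ≤ Real.exp (-(l * max t 0)) *
          (‖x‖ + M * (‖C‖ * ‖w‖) / l * Real.exp (l * max t 0)) := by gcongr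
      _ = Real.exp (-(l * max t 0)) * ‖x‖ + M * (‖C‖ * ‖w‖) / l := by
          rw [mul_add, mul_left_comm, hexp, mul_one]
      _ ≤ _ := by gcongr; exact mul_le_of_le_one_left (norm_nonneg _) h2
  let Φ : BoundedContinuousFunction ℝ H → BoundedContinuousFunction ℝ H := fun w =>
    BoundedContinuousFunction.ofNormedAddCommGroup (F w) (hF w) _ (hFn w)
  have hIsub : ∀ w w' t, I w t - I w' t = I (w - w') t := by
    intro w w' t
    have hint : ∀ w, IntervalIntegrable (fun s => c s • S (t - s) (g w s)) volume 0 t := fun w =>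
      intervalIntegrable_smul_of_bounded hc hM
        (hS.continuous_apply (f := fun s => t - s) (by fun_prop) (hg w)) 0 t
    simp only [I]
    rw [← intervalIntegral.integral_sub (hint w) (hint w')]
    simp only [g, ← smul_sub, ← map_sub]
    rfl
  have hΦ : ContractingWith (1 / 2) Φ := by
    refine ⟨by rw [← NNReal.coe_lt_coe]; norm_num, LipschitzWith.of_dist_le_mul fun w w' => ?_⟩
    rw [BoundedContinuousFunction.dist_le (by positivity)]
    intro t
    have ht : 0 ≤ max t 0 := le_max_right _ _
    have h0 : Φ w t - Φ w' t = Real.exp (-(l * max t 0)) • I (w - w') (max t 0) := by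
      change F w t - F w' t = _
      simp only [F, ← smul_sub, add_sub_add_left_eq_sub, hIsub]
    rw [dist_eq_norm, h0, norm_smul, Real.norm_eq_abs, Real.abs_exp, dist_eq_norm]
    calc _ ≤ Real.exp (-(l * max t 0)) *
          (M * (‖C‖ * ‖w - w'‖) / l * Real.exp (l * max t 0)) := by
          gcongr; exact hIn _ _ ht
      _ = M * ‖C‖ / l * ‖w - w'‖ := by rw [mul_left_comm, hexp]; ring
      _ ≤ _ := by
          gcongr
          rw [div_le_iff₀ hl0, hl]
          simp only [NNReal.coe_div, NNReal.coe_one, NNReal.coe_ofNat]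
          linarith
  have hfix : ∃ w, Φ w = w := ⟨_, hΦ.fixedPoint_isFixedPt⟩
  obtain ⟨w, hw⟩ := hfix
  refine ⟨fun t => Real.exp (l * t) • w t, ⟨?_, fun t ht => ?_⟩⟩
  · exact (by fun_prop : Continuous fun s => Real.exp (l * s)).smul w.continuous
  · have h1 : w t = F w t := by
      conv_lhs => rw [← hw]
      rfl
    simp only [h1, F, max_eq_left ht, smul_smul]
    rw [mul_comm, hexp, one_smul]
    congr 1
    refine intervalIntegral.integral_congr fun s hs => ?_
    have h2 : C (Real.exp (l * s) • w s) = g w s := by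
      simp only [g, RCLike.real_smul_eq_coe_smul (K := 𝕜), map_smul]
    rw [← h2]

end Duhamel

/-! ### Generators, dissipativity and contractivity. -/

section Generator

open Asymptotics

variable {𝕜 H : Type*} [RCLike 𝕜] [NormedAddCommGroup H] [InnerProductSpace 𝕜 H]

theorem tendsto_inv_smul_iff_isLittleO {f : ℝ → H} {y : H} :
    Tendsto (fun h : ℝ => ((h⁻¹ : ℝ) : 𝕜) • f h) (𝓝[>] 0) (𝓝 y) ↔
      (fun h : ℝ => f h - (h : 𝕜) • y) =o[𝓝[>] 0] (fun h : ℝ => h) := by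
  rw [tendsto_iff_norm_sub_tendsto_zero, ← isLittleO_norm_left, isLittleO_iff_tendsto']
  · refine tendsto_congr' ?_
    filter_upwards [self_mem_nhdsWithin] with h hh
    have hh : 0 < h := hh
    have h0 : (h : 𝕜) ≠ 0 := RCLike.ofReal_ne_zero.2 hh.ne'
    have h1 : f h - (h : 𝕜) • y = (h : 𝕜) • (((h⁻¹ : ℝ) : 𝕜) • f h - y) := by
      rw [smul_sub, smul_smul, RCLike.ofReal_inv, mul_inv_cancel₀ h0, one_smul]
    rw [h1, norm_smul, RCLike.norm_ofReal, abs_of_pos hh]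
    field_simp
  · filter_upwards [self_mem_nhdsWithin] with h hh h0
    exact absurd h0 (ne_of_gt hh)

theorem norm_add_sq_eq_re_inner_swap {u z : H} :
    ‖u + z‖ ^ 2 = ‖u‖ ^ 2 + 2 * RCLike.re (inner 𝕜 z u) + ‖z‖ ^ 2 := by
  rw [norm_add_sq (𝕜 := 𝕜), inner_re_symm]

theorem isLittleO_norm_sq {z : ℝ → H} (hz : z =O[𝓝[>] 0] (fun h : ℝ => h)) :
    (fun h => ‖z h‖ ^ 2) =o[𝓝[>] 0] (fun h : ℝ => h) := by
  have h1 : (fun h => ‖z h‖ ^ 2) =O[𝓝[>] 0] (fun h : ℝ => h ^ 2) := hz.norm_left.pow 2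
  refine h1.trans_isLittleO ?_
  have : (fun h : ℝ => h ^ 2) =o[𝓝 0] (fun h : ℝ => h ^ 1) := isLittleO_pow_pow one_lt_two
  simpa using this.mono nhdsWithin_le_nhds

/-- A curve whose right derivatives are dissipative has nonincreasing norm. -/
theorem norm_le_of_dissipative_right_deriv {u : ℝ → H} (hu : ContinuousOn u (Ici 0))
    (h : ∀ t, 0 ≤ t → ∃ y, RCLike.re (inner 𝕜 y (u t)) ≤ 0 ∧
      (fun h : ℝ => u (t + h) - u t - (h : 𝕜) • y) =o[𝓝[>] 0] (fun h : ℝ => h))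
    {t : ℝ} (ht : 0 ≤ t) : ‖u t‖ ≤ ‖u 0‖ := by
  have hcont : Continuous fun t => u (max t 0) :=
    hu.comp_continuous (by fun_prop) fun t => mem_Ici.2 (le_max_right t 0)
  have key := le_of_forall_isLittleO (φ := fun t => ‖u (max t 0)‖ ^ 2) (hcont.norm.pow 2) ?_ le_rfl ht
  · simp only [max_self, max_eq_left ht] at key
    exact le_of_sq_le_sq key (norm_nonneg _)
  intro t ht
  obtain ⟨y, hy, hr⟩ := h t ht
  set r := fun h : ℝ => u (t + h) - u t - (h : 𝕜) • y with hrdef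
  have hO : (fun h : ℝ => (h : 𝕜) • y + r h) =O[𝓝[>] 0] (fun h : ℝ => h) := by
    refine IsBigO.add (IsBigO.of_bound ‖y‖ (Eventually.of_forall fun h => ?_)) hr.isBigO
    rw [norm_smul, RCLike.norm_ofReal, Real.norm_eq_abs, mul_comm]
  refine ⟨_, (hr.norm_left.const_mul_left (2 * ‖u t‖)).add (isLittleO_norm_sq hO), ?_⟩
  filter_upwards [self_mem_nhdsWithin] with h hh
  have hh : 0 < h := hh
  have h1 : u (t + h) = u t + ((h : 𝕜) • y + r h) := by simp [hrdef]
  rw [max_eq_left (by linarith), max_eq_left ht]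
  rw [h1, norm_add_sq_eq_re_inner_swap (𝕜 := 𝕜), add_assoc, inner_add_left, inner_smul_left, map_add]
  have h2 : RCLike.re ((starRingEnd 𝕜) (h : 𝕜) * inner 𝕜 y (u t)) ≤ 0 := by
    rw [RCLike.conj_ofReal, RCLike.re_ofReal_mul]
    exact mul_nonpos_of_nonneg_of_nonpos hh.le hy
  have h3 : RCLike.re (inner 𝕜 (r h) (u t)) ≤ ‖r h‖ * ‖u t‖ := re_inner_le_norm _ _
  nlinarith

variable {A : H →ₗ.[𝕜] H} {S S' : ℝ → H →L[𝕜] H}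

theorem IsDissipativeOp.re_inner_le (hA : IsDissipativeOp A) {x y : H} (h : (x, y) ∈ A.graph) :
    RCLike.re (inner 𝕜 y x) ≤ 0 := by
  obtain ⟨z, rfl, rfl⟩ := (LinearPMap.mem_graph_iff A).1 h
  exact hA z

theorem IsInfinitesimalGenerator.isLittleO (h : IsInfinitesimalGenerator A S) {x y : H}
    (hxy : (x, y) ∈ A.graph) :
    (fun h : ℝ => S h x - x - (h : 𝕜) • y) =o[𝓝[>] 0] (fun h : ℝ => h) :=
  tendsto_inv_smul_iff_isLittleO.1 ((h x y).1 hxy)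

/-- `S t` is continuous and commutes with the difference quotients `(S h - 1) / h`. -/
theorem IsInfinitesimalGenerator.apply_mem_graph (hg : IsInfinitesimalGenerator A S)
    (hS : IsC0Semigroup S) {x y : H} (hxy : (x, y) ∈ A.graph) {t : ℝ} (ht : 0 ≤ t) :
    (S t x, S t y) ∈ A.graph := by
  rw [hg]
  have h1 := ((S t).continuous.tendsto y).comp ((hg x y).1 hxy)
  refine h1.congr' ?_
  filter_upwards [self_mem_nhdsWithin] with h hh
  have hh : 0 < h := hh
  have h2 : S h (S t x) = S t (S h x) := by
    rw [← ContinuousLinearMap.comp_apply, ← ContinuousLinearMap.comp_apply, ← hS.add h t hh.le ht,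
      ← hS.add t h ht hh.le, add_comm]
  simp [h2, map_sub]

theorem IsInfinitesimalGenerator.apply_isLittleO (hg : IsInfinitesimalGenerator A S)
    (hS : IsC0Semigroup S) {x y : H} (hxy : (x, y) ∈ A.graph) {t : ℝ} (ht : 0 ≤ t) :
    (fun h : ℝ => S (t + h) x - S t x - (h : 𝕜) • S t y) =o[𝓝[>] 0] (fun h : ℝ => h) := by
  refine (hg.isLittleO (hg.apply_mem_graph hS hxy ht)).congr' ?_ .rfl
  filter_upwards [self_mem_nhdsWithin] with h hh
  rw [add_comm t h, hS.add h t (le_of_lt hh) ht]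
  rfl

theorem IsInfinitesimalGenerator.congr (hg : IsInfinitesimalGenerator A S)
    (h : ∀ t, 0 ≤ t → S' t = S t) : IsInfinitesimalGenerator A S' := by
  intro x y
  rw [hg]
  refine tendsto_congr' ?_
  filter_upwards [self_mem_nhdsWithin] with t ht
  rw [h t (le_of_lt ht)]

theorem exists_mem_graph {x : H} (hx : x ∈ A.domain) : ∃ y, (x, y) ∈ A.graph :=
  ⟨A ⟨x, hx⟩, LinearPMap.mem_graph A ⟨x, hx⟩⟩

/-- For `x` in the domain the orbit has dissipative right derivatives; density and continuity of `S
t` do the rest. -/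
theorem IsC0Semigroup.norm_apply_le (hS : IsC0Semigroup S) (hg : IsInfinitesimalGenerator A S)
    (hd : Dense (A.domain : Set H)) (hA : IsDissipativeOp A) {t : ℝ} (ht : 0 ≤ t) (x : H) :
    ‖S t x‖ ≤ ‖x‖ := by
  revert x
  have hcl : IsClosed {x | ‖S t x‖ ≤ ‖x‖} := isClosed_le (S t).continuous.norm continuous_norm
  refine fun x => hcl.closure_subset_iff.2 ?_ (hd x)
  intro x hx
  obtain ⟨y, hxy⟩ := exists_mem_graph hx
  have := norm_le_of_dissipative_right_deriv (𝕜 := 𝕜) (hS.cont x) (fun t ht =>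
    ⟨S t y, hA.re_inner_le (hg.apply_mem_graph hS hxy ht), hg.apply_isLittleO hS hxy ht⟩) ht
  simpa [hS.zero] using this

theorem IsC0Semigroup.isContractionSemigroup (hS : IsC0Semigroup S)
    (hg : IsInfinitesimalGenerator A S) (hd : Dense (A.domain : Set H)) (hA : IsDissipativeOp A) :
    IsContractionSemigroup (fun t => S (max t 0)) where
  zero := by simp [hS.zero]
  add s t hs ht := by
    simp only [max_eq_left hs, max_eq_left ht, max_eq_left (add_nonneg hs ht)]
    exact hS.add s t hs ht
  norm_le t x := hS.norm_apply_le hg hd hA (le_max_right _ _) x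
  cont x := (hS.cont x).comp_continuous (by fun_prop) fun t => mem_Ici.2 (le_max_right t 0)

/-- A semigroup is determined by its generator (here: a densely defined dissipative one). -/
theorem IsC0Semigroup.eq_of_generator (hS : IsC0Semigroup S) (hS' : IsC0Semigroup S')
    (hg : IsInfinitesimalGenerator A S) (hg' : IsInfinitesimalGenerator A S')
    (hd : Dense (A.domain : Set H)) (hA : IsDissipativeOp A) {t : ℝ} (ht : 0 ≤ t) :
    S t = S' t := by
  refine DFunLike.coe_injective (Continuous.ext_on hd (S t).continuous (S' t).continuous ?_)
  intro x hx
  obtain ⟨y, hxy⟩ := exists_mem_graph hx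
  have := norm_le_of_dissipative_right_deriv (𝕜 := 𝕜) (u := fun t => S t x - S' t x)
    ((hS.cont x).sub (hS'.cont x)) (fun t ht => ⟨S t y - S' t y, hA.re_inner_le
      (A.graph.sub_mem (hg.apply_mem_graph hS hxy ht) (hg'.apply_mem_graph hS' hxy ht)), ?_⟩) ht
  · simpa [hS.zero, hS'.zero, sub_eq_zero] using this
  · refine ((hg.apply_isLittleO hS hxy ht).sub (hg'.apply_isLittleO hS' hxy ht)).congr_left ?_
    intro h
    rw [smul_sub]
    abel

end Generator

/-! ### The damping operator and the feedback operator. -/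

section Feedback

open Asymptotics

variable {𝕜 H U : Type*} [RCLike 𝕜]
    [NormedAddCommGroup H] [InnerProductSpace 𝕜 H] [CompleteSpace H]
    [NormedAddCommGroup U] [InnerProductSpace 𝕜 U] [CompleteSpace U]
    {A : H →ₗ.[𝕜] H} {B : U →L[𝕜] H} {c : ℝ}

theorem inner_dampingOp (B : U →L[𝕜] H) (x y : H) :
    inner 𝕜 (dampingOp B x) y =
      inner 𝕜 (ContinuousLinearMap.adjoint B x) (ContinuousLinearMap.adjoint B y) := by
  rw [dampingOp, ContinuousLinearMap.comp_apply, ContinuousLinearMap.adjoint_inner_right]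

theorem re_inner_dampingOp_self (B : U →L[𝕜] H) (x : H) :
    RCLike.re (inner 𝕜 (dampingOp B x) x) = ‖ContinuousLinearMap.adjoint B x‖ ^ 2 := by
  rw [inner_dampingOp, inner_self_eq_norm_sq]

theorem norm_dampingOp_le (B : U →L[𝕜] H) (x : H) :
    ‖dampingOp B x‖ ≤ ‖B‖ * ‖ContinuousLinearMap.adjoint B x‖ :=
  B.le_opNorm _

theorem mem_graph_feedbackOp {x y : H} :
    (x, y) ∈ (feedbackOp A B c).graph ↔ (x, y + (c : 𝕜) • dampingOp B x) ∈ A.graph := by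
  constructor
  · intro h
    obtain ⟨z, rfl, rfl⟩ := (LinearPMap.mem_graph_iff _).1 h
    refine (LinearPMap.mem_graph_iff _).2 ⟨z, rfl, ?_⟩
    change A z = A z - (c : 𝕜) • dampingOp B (z : H) + (c : 𝕜) • dampingOp B (z : H)
    abel
  · intro h
    obtain ⟨z, hz, hy⟩ := (LinearPMap.mem_graph_iff _).1 h
    subst hz
    refine (LinearPMap.mem_graph_iff _).2 ⟨z, rfl, ?_⟩
    change A z - (c : 𝕜) • dampingOp B (z : H) = y
    rw [hy]
    exact add_sub_cancel_right _ _

theorem IsDissipativeOp.feedbackOp (hA : IsDissipativeOp A) (hc : 0 ≤ c) :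
    IsDissipativeOp (feedbackOp A B c) := by
  intro (x : A.domain)
  change RCLike.re (inner 𝕜 (A x - (c : 𝕜) • dampingOp B (x : H)) (x : H)) ≤ 0
  rw [inner_sub_left, inner_smul_left, map_sub, RCLike.conj_ofReal, RCLike.re_ofReal_mul]
  have h1 := hA x
  have h2 := re_inner_dampingOp_self B (x : H)
  have : 0 ≤ c * RCLike.re (inner 𝕜 (dampingOp B (x : H)) (x : H)) := by rw [h2]; positivity
  linarith

end Feedback

/-! ### Bounded perturbations of contraction semigroups. -/

section Perturbation

open Asymptotics

variable {𝕜 H : Type*} [RCLike 𝕜] [NormedAddCommGroup H] [InnerProductSpace 𝕜 H]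
  [NormedSpace ℝ H] [IsScalarTower ℝ 𝕜 H] [CompleteSpace H]
  {S T : ℝ → H →L[𝕜] H} {C : H →L[𝕜] H}

/-- A bounded perturbation of a contraction semigroup is a strongly continuous semigroup. -/
theorem exists_perturbed_semigroup (hT : IsContractionSemigroup T) (C : H →L[𝕜] H) (c : ℝ) :
    ∃ S : ℝ → H →L[𝕜] H, IsC0Semigroup S ∧
      ∀ x, IsDuhamelSolution T C (fun _ => c) x (fun t => S t x) := by
  have hc : Measurable (fun _ : ℝ => c) := measurable_const
  have hM : ∀ s : ℝ, |(fun _ : ℝ => c) s| ≤ |c| := fun _ => le_rfl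
  choose v hv using fun x => exists_isDuhamelSolution hT C hc hM x
  let S : ℝ → H →L[𝕜] H := fun t => LinearMap.mkContinuous
    { toFun := fun x => v x (max t 0)
      -- Linearity in the initial state is uniqueness for the linear equation, and so is the
      -- semigroup law below, after a time shift.
      map_add' := fun x y => (hv (x + y)).unique ((hv x).add (hv y) hT hc hM) hT hc hM
        (le_max_right _ _)
      map_smul' := fun r x => (hv (r • x)).unique ((hv x).const_smul r) hT hc hM
        (le_max_right _ _) }
    (Real.exp (|c| * ‖C‖ * max t 0)) (fun x => by
      rw [mul_comm]; exact (hv x).norm_le hT hc hM (le_max_right _ _))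
  have hSv : ∀ t x, S t x = v x (max t 0) := fun t x => rfl
  have hScont : ∀ x, Continuous fun t => S t x := fun x =>
    (hv x).cont.comp (by fun_prop : Continuous fun t : ℝ => max t 0)
  have hS : ∀ x, IsDuhamelSolution T C (fun _ => c) x (fun t => S t x) := fun x =>
    (hv x).congr (hScont x) fun t ht => by rw [hSv, max_eq_left ht]
  refine ⟨S, ⟨?_, ?_, fun x => (hScont x).continuousOn⟩, hS⟩
  · ext x
    exact (hS x).map_zero hT
  · intro s t hs ht
    ext x
    exact ((hS x).shift hT hc hM ht).unique (hS (S t x)) hT hc hM hs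

theorem IsDuhamelSolution.semigroup_isLittleO {c : ℝ} {x : H}
    (hS : IsDuhamelSolution T C (fun _ => c) x (fun t => S t x)) (hT : IsContractionSemigroup T) :
    (fun h : ℝ => S h x - T h x - (h * c) • C x) =o[𝓝[>] 0] (fun h : ℝ => h) := by
  have h0 := hS.map_zero hT
  have := hS.isLittleO hT measurable_const (fun _ => le_rfl : ∀ _, |c| ≤ |c|) le_rfl
  simpa [h0] using this

/-- The variation of constants formula with respect to `S` implies the one with respect to a
semigroup `T` of which `S` is a bounded perturbation. -/
theorem IsDuhamelSolution.change_semigroup (hS : IsContractionSemigroup S)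
    (hT : IsContractionSemigroup T) {k : ℝ}
    (hST : ∀ x, IsDuhamelSolution T C (fun _ => k) x (fun t => S t x)) {c : ℝ → ℝ}
    (hc : Measurable c) {M : ℝ} (hM : ∀ s, |c s| ≤ M) {x : H} {v : ℝ → H}
    (hv : IsDuhamelSolution S C c x v) : IsDuhamelSolution T C (fun s => k + c s) x v := by
  have hc' : Measurable fun s => k + c s := hc.const_add k
  have hM' : ∀ s, |k + c s| ≤ |k| + M := fun s => (abs_add_le _ _).trans (by gcongr; exact hM s)
  have hg : Continuous fun s => C (v s) := C.continuous.comp hv.cont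
  set I : ℝ → H := fun t => ∫ s in (0 : ℝ)..t, (k + c s) • T (t - s) (C (v s)) with hI
  have hIc : Continuous I := hT.continuous_integral hc' hM' hg
  refine ⟨hv.cont, fun t ht => ?_⟩
  have hcont : Continuous fun t => v t - (T t x + I t) := hv.cont.sub ((hT.cont x).add hIc)
  -- The defect `ψ = v - (T x + I)` vanishes at `0` and satisfies `ψ (t + h) = T h (ψ t) + o(h)`, so
  -- its norm cannot grow.
  have key := le_of_forall_isLittleO (φ := fun t => ‖v t - (T t x + I t)‖) hcont.norm ?_ le_rfl ht
  · have h0 : ‖v t - (T t x + I t)‖ ≤ 0 := by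
      simpa [hv.map_zero hS, hT.zero, hI] using key
    exact sub_eq_zero.1 (norm_le_zero_iff.1 h0)
  intro t ht
  -- The three errors come from `v` expanded along `S`, from `I` expanded along `T`, and from `S h -
  -- T h = h k C + o(h)` at `v t`.
  refine ⟨_, (((hv.isLittleO hS hc hM ht).sub (hT.integral_sub_isLittleO hc' hM' hg t)).add
    ((hST (v t)).semigroup_isLittleO hT)).norm_left, ?_⟩
  filter_upwards [self_mem_nhdsWithin] with h hh
  have hh : 0 < h := hh
  have hI' : I (t + h) = T h (I t) + ∫ s in t..t + h, (k + c s) • T (t + h - s) (C (v s)) :=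
    hT.integral_add hc' hM' hg ht hh.le
  have hci : IntervalIntegrable c volume t (t + h) := by
    simpa using intervalIntegrable_smul_of_bounded hc hM (g := fun _ => (1 : ℝ))
      continuous_const t (t + h)
  have hint : ∫ s in t..t + h, (k + c s) = h * k + ∫ s in t..t + h, c s := by
    rw [intervalIntegral.integral_add (by simp) hci]
    simp
  have hTadd : T (t + h) x = T h (T t x) := by
    rw [add_comm, hT.add h t hh.le ht]
    rfl
  rw [hI', hint, hTadd]
  refine (le_of_eq ?_).trans ((norm_add_le (T h (v t - (T t x + I t))) _).trans
    (add_le_add_left (hT.norm_le h _) _))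
  congr 1
  simp only [map_sub, map_add, add_smul]
  abel

end Perturbation

/-! ### The energy inequality. -/

section Energy

open Asymptotics

variable {𝕜 H U : Type*} [RCLike 𝕜]
    [NormedAddCommGroup H] [InnerProductSpace 𝕜 H] [CompleteSpace H]
    [NormedSpace ℝ H] [IsScalarTower ℝ 𝕜 H]
    [NormedAddCommGroup U] [InnerProductSpace 𝕜 U] [CompleteSpace U]
    {A : H →ₗ.[𝕜] H} {B : U →L[𝕜] H} {S T : ℝ → H →L[𝕜] H}

theorem isLittleO_norm_mul_norm_of_tendsto_zero {E F : Type*} [NormedAddCommGroup E]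
    [NormedAddCommGroup F] {z : ℝ → E} {r : ℝ → F} (hz : Tendsto z (𝓝[>] 0) (𝓝 0))
    (hr : r =O[𝓝[>] 0] (fun h : ℝ => h)) :
    (fun h => ‖z h‖ * ‖r h‖) =o[𝓝[>] 0] (fun h : ℝ => h) := by
  have h1 : (fun h => ‖z h‖) =o[𝓝[>] 0] (fun _ : ℝ => (1 : ℝ)) :=
    ((isLittleO_one_iff ℝ).2 hz).norm_left
  simpa using h1.mul_isBigO hr.norm_left

/-- The energy inequality for the damped evolution. -/
theorem IsDuhamelSolution.energy_le (hS : IsContractionSemigroup S) {d : ℝ → ℝ} {d₀ D : ℝ}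
    (hd : Measurable d) (hd₀ : 0 < d₀) (hd_ge : ∀ s, d₀ ≤ d s) (hd_le : ∀ s, d s ≤ D) {x : H}
    {v : ℝ → H} (hv : IsDuhamelSolution S (dampingOp B) (fun s => -d s) x v) {t : ℝ}
    (ht : 0 ≤ t) :
    ‖v t‖ ^ 2 + 2 * d₀ * ∫ s in (0 : ℝ)..t, ‖ContinuousLinearMap.adjoint B (v s)‖ ^ 2 ≤
      ‖x‖ ^ 2 := by
  set q : ℝ → ℝ := fun s => ‖ContinuousLinearMap.adjoint B (v s)‖ ^ 2 with hq
  have hqc : Continuous q := ((ContinuousLinearMap.continuous _).comp hv.cont).norm.pow 2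
  have hM : ∀ s, |-d s| ≤ D := fun s => by
    rw [abs_neg, abs_of_pos (hd₀.trans_le (hd_ge s))]; exact hd_le s
  have hdI : ∀ a b, IntervalIntegrable d volume a b := fun a b => by
    simpa using intervalIntegrable_smul_of_bounded hd (M := D)
      (fun s => by rw [← abs_neg]; exact hM s) (g := fun _ => (1 : ℝ)) continuous_const a b
  have key := le_of_forall_isLittleO
    (φ := fun t => ‖v t‖ ^ 2 + 2 * d₀ * ∫ s in (0 : ℝ)..t, q s)
    ((hv.cont.norm.pow 2).add (continuous_const.mul
      (intervalIntegral.continuous_primitive (fun a b => hqc.intervalIntegrable a b) 0)))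
    ?_ le_rfl ht
  · simpa [hv.map_zero hS] using key
  clear ht t
  intro t ht
  set r := fun h => v (t + h) - S h (v t) - (∫ s in t..t + h, -d s) • dampingOp B (v t) with hr
  have hro : r =o[𝓝[>] 0] (fun h : ℝ => h) := hv.isLittleO hS hd.neg hM ht
  set p := fun h => (∫ s in t..t + h, -d s) • dampingOp B (v t) with hp
  have hpO : p =O[𝓝[>] 0] (fun h : ℝ => h) := by
    refine IsBigO.of_bound (D * ‖dampingOp B (v t)‖) ?_
    filter_upwards [self_mem_nhdsWithin] with h hh
    have hh : 0 < h := hh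
    rw [hp, norm_smul, Real.norm_eq_abs, Real.norm_eq_abs, abs_of_pos hh, mul_right_comm]
    gcongr
    exact abs_integral_le_of_bounded hM t hh.le
  -- Strong continuity gives no rate here, but the difference is only ever paired with `p h = O(h)`,
  -- so the product is `o(h)`.
  have hz : Tendsto (fun h => S h (v t) - v t) (𝓝[>] 0) (𝓝 0) := by
    have h1 : Tendsto (fun h => S h (v t) - v t) (𝓝 0) (𝓝 (S 0 (v t) - v t)) :=
      ((hS.cont (v t)).sub continuous_const).tendsto 0
    rw [hS.zero, ContinuousLinearMap.id_apply, sub_self] at h1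
    exact h1.mono_left nhdsWithin_le_nhds
  have hqo : (fun h : ℝ => (∫ s in (0 : ℝ)..t + h, q s) - (∫ s in (0 : ℝ)..t, q s) - h * q t)
      =o[𝓝[>] 0] (fun h : ℝ => h) := by
    have h1 : HasDerivAt (fun u => ∫ s in (0 : ℝ)..u, q s) (q t) t :=
      intervalIntegral.integral_hasDerivAt_right (hqc.intervalIntegrable _ _)
        hqc.stronglyMeasurable.stronglyMeasurableAtFilter hqc.continuousAt
    exact (hasDerivAt_iff_isLittleO_nhds_zero.1 h1).mono nhdsWithin_le_nhds
  refine ⟨_, (((isLittleO_norm_sq (hpO.add hro.isBigO)).add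
    (hro.norm_left.const_mul_left (2 * ‖v t‖))).add
    ((isLittleO_norm_mul_norm_of_tendsto_zero hz hpO).const_mul_left 2)).add
    (hqo.const_mul_left (2 * d₀)), ?_⟩
  filter_upwards [self_mem_nhdsWithin] with h hh
  have hh : 0 < h := hh
  set m := ∫ s in t..t + h, d s with hm
  have hmge : d₀ * h ≤ m := by
    have := intervalIntegral.integral_mono_on (f := fun _ => d₀) (by linarith : t ≤ t + h)
      (by simp) (hdI t (t + h)) (fun s _ => hd_ge s)
    simpa [mul_comm] using this
  have hpm : p h = -(m • dampingOp B (v t)) := by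
    simp only [hp, hm, intervalIntegral.integral_neg, neg_smul]
  have hvh : v (t + h) = S h (v t) + (p h + r h) := by
    simp only [hr, hp]; abel
  have h1 : RCLike.re (inner 𝕜 (p h) (S h (v t))) ≤
      -(d₀ * h * q t) + ‖S h (v t) - v t‖ * ‖p h‖ := by
    -- Against `v t` itself the forcing produces exactly `-m * ‖B⋆ (v t)‖²`, with `m ≥ d₀ * h`.
    have e1 : S h (v t) = v t + (S h (v t) - v t) := by abel
    have e2 : RCLike.re (inner 𝕜 (p h) (S h (v t) - v t)) ≤ ‖p h‖ * ‖S h (v t) - v t‖ :=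
      re_inner_le_norm _ _
    have e3 : RCLike.re (inner 𝕜 (p h) (v t)) = -(m * q t) := by
      rw [hpm, inner_neg_left, map_neg, RCLike.real_smul_eq_coe_smul (K := 𝕜), inner_smul_left,
        RCLike.conj_ofReal, RCLike.re_ofReal_mul, re_inner_dampingOp_self]
    have e4 : d₀ * h * q t ≤ m * q t := mul_le_mul_of_nonneg_right hmge (by positivity)
    conv_lhs => rw [e1]
    rw [inner_add_right, map_add]
    linarith
  have h2 : RCLike.re (inner 𝕜 (r h) (S h (v t))) ≤ ‖v t‖ * ‖r h‖ := by
    refine (re_inner_le_norm _ _).trans ?_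
    rw [mul_comm]
    gcongr
    exact hS.norm_le _ _
  have h3 : ‖S h (v t)‖ ^ 2 ≤ ‖v t‖ ^ 2 := by
    gcongr
    exact hS.norm_le _ _
  rw [hvh, norm_add_sq_eq_re_inner_swap (𝕜 := 𝕜), inner_add_left, map_add]
  nlinarith

end Energy

/-! ### Uniform contraction over one time step and exponential decay. -/

section Decay

variable {𝕜 H U : Type*} [RCLike 𝕜]
    [NormedAddCommGroup H] [InnerProductSpace 𝕜 H] [CompleteSpace H]
    [NormedSpace ℝ H]
    [NormedAddCommGroup U] [InnerProductSpace 𝕜 U] [CompleteSpace U]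
    {B : U →L[𝕜] H} {S T : ℝ → H →L[𝕜] H}

/-- Cauchy–Schwarz, read off from the nonnegative integral of `(τ f - J)²`. -/
theorem sq_integral_le_mul_integral_sq {f : ℝ → ℝ} (hf : Continuous f) {τ : ℝ} (hτ : 0 < τ) :
    (∫ s in (0 : ℝ)..τ, f s) ^ 2 ≤ τ * ∫ s in (0 : ℝ)..τ, f s ^ 2 := by
  set J := ∫ s in (0 : ℝ)..τ, f s with hJ
  have h1 : 0 ≤ ∫ s in (0 : ℝ)..τ, (τ * f s - J) ^ 2 :=
    intervalIntegral.integral_nonneg hτ.le fun s _ => sq_nonneg _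
  have h2 : ∫ s in (0 : ℝ)..τ, (τ * f s - J) ^ 2 =
      τ ^ 2 * (∫ s in (0 : ℝ)..τ, f s ^ 2) - 2 * τ * J * J + τ * J ^ 2 := by
    have e : ∀ s, (τ * f s - J) ^ 2 = τ ^ 2 * f s ^ 2 - 2 * τ * J * f s + J ^ 2 :=
      fun s => by ring
    simp only [e]
    rw [intervalIntegral.integral_add, intervalIntegral.integral_sub,
      intervalIntegral.integral_const_mul, intervalIntegral.integral_const_mul, ← hJ]
    · simp
    all_goals exact Continuous.intervalIntegrable (by fun_prop) _ _
  have h3 : 0 ≤ τ * (τ * (∫ s in (0 : ℝ)..τ, f s ^ 2) - J ^ 2) := by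
    rw [h2] at h1
    linarith
  linarith [nonneg_of_mul_nonneg_right h3 hτ]

/-- The damping observed along a solution controls its deviation from the semigroup `T`. -/
theorem IsDuhamelSolution.norm_sq_le (hT : IsContractionSemigroup T) {c : ℝ → ℝ} {D : ℝ}
    (hc : ∀ s, |c s| ≤ D) {x : H} {v : ℝ → H}
    (hv : IsDuhamelSolution T (dampingOp B) c x v) {τ : ℝ} (hτ : 0 < τ) :
    ‖v τ‖ ^ 2 ≤ 2 * ‖T τ x‖ ^ 2 + 2 * (D * ‖B‖) ^ 2 * τ *
      ∫ s in (0 : ℝ)..τ, ‖ContinuousLinearMap.adjoint B (v s)‖ ^ 2 := by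
  have hD : 0 ≤ D := (abs_nonneg _).trans (hc 0)
  set f : ℝ → ℝ := fun s => ‖ContinuousLinearMap.adjoint B (v s)‖ with hf
  have hfc : Continuous f := ((ContinuousLinearMap.continuous _).comp hv.cont).norm
  have h1 : ‖∫ s in (0 : ℝ)..τ, c s • T (τ - s) (dampingOp B (v s))‖ ≤
      ∫ s in (0 : ℝ)..τ, D * ‖B‖ * f s := by
    refine intervalIntegral.norm_integral_le_of_norm_le hτ.le
      (Eventually.of_forall fun s _ => ?_) ((continuous_const.mul hfc).intervalIntegrable _ _)
    rw [norm_smul, mul_assoc]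
    exact mul_le_mul (hc s) ((hT.norm_le _ _).trans (norm_dampingOp_le B _)) (norm_nonneg _) hD
  rw [intervalIntegral.integral_const_mul] at h1
  have h2 : ‖v τ‖ ≤ ‖T τ x‖ + D * ‖B‖ * ∫ s in (0 : ℝ)..τ, f s := by
    rw [hv.eq τ hτ.le]
    exact (norm_add_le _ _).trans (by gcongr)
  have h3 := sq_integral_le_mul_integral_sq hfc hτ
  have h4 : ‖v τ‖ ^ 2 ≤ (‖T τ x‖ + D * ‖B‖ * ∫ s in (0 : ℝ)..τ, f s) ^ 2 := by gcongr
  calc ‖v τ‖ ^ 2 ≤ 2 * ‖T τ x‖ ^ 2 + 2 * ((D * ‖B‖) ^ 2 * (∫ s in (0 : ℝ)..τ, f s) ^ 2) := by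
        nlinarith [sq_nonneg (‖T τ x‖ - D * ‖B‖ * ∫ s in (0 : ℝ)..τ, f s)]
    _ ≤ 2 * ‖T τ x‖ ^ 2 + 2 * ((D * ‖B‖) ^ 2 * (τ * ∫ s in (0 : ℝ)..τ, f s ^ 2)) := by gcongr
    _ = _ := by ring

variable [IsScalarTower ℝ 𝕜 H]

/-- Over a suitable time step, every damped evolution contracts the norm by a fixed factor. -/
theorem exists_uniform_contraction (B : U →L[𝕜] H) (hS : IsContractionSemigroup S)
    (hT : IsContractionSemigroup T) {d₀ : ℝ} (hd₀ : 0 < d₀)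
    (hST : ∀ x, IsDuhamelSolution T (dampingOp B) (fun _ => d₀) x (fun t => S t x))
    {K₀ β₀ : ℝ} (hβ₀ : 0 < β₀)
    (hstab : ∀ x t, 0 ≤ t → ‖T t x‖ ≤ K₀ * Real.exp (-β₀ * t) * ‖x‖) (D : ℝ) :
    ∃ τ > (0 : ℝ), ∃ ρ, 0 < ρ ∧ ρ < 1 ∧ ∀ (d : ℝ → ℝ), Measurable d → (∀ s, d₀ ≤ d s) →
      (∀ s, d s ≤ D) → ∀ x v, IsDuhamelSolution S (dampingOp B) (fun s => -d s) x v →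
      ‖v τ‖ ≤ ρ * ‖x‖ := by
  have hlim : Tendsto (fun t => K₀ * Real.exp (-β₀ * t)) atTop (𝓝 (K₀ * 0)) := by
    refine (Real.tendsto_exp_atBot.comp ?_).const_mul K₀
    exact tendsto_id.const_mul_atTop_of_neg (neg_neg_of_pos hβ₀)
  rw [mul_zero] at hlim
  obtain ⟨τ, hτle, hτ⟩ := ((hlim.eventually (eventually_le_nhds (by norm_num : (0 : ℝ) < 1 / 2))).and
    (eventually_gt_atTop 0)).exists
  -- The exchange rate that turns the deviation term into `M` times the dissipated energy `2 * d₀ *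
  -- Q`.
  set M := (D * ‖B‖) ^ 2 * τ / d₀ with hM
  have hM0 : 0 ≤ M := by positivity
  have hM1 : 0 < 1 + M := by positivity
  -- Solves `‖v τ‖² ≤ ‖x‖² / 2 + M (‖x‖² - ‖v τ‖²)` for `‖v τ‖²`; the `1 / 2` is `2 * (1 / 2)²`.
  refine ⟨τ, hτ, √((1 / 2 + M) / (1 + M)), Real.sqrt_pos.2 (by positivity), ?_, ?_⟩
  · rw [Real.sqrt_lt' one_pos, one_pow, div_lt_one hM1]
    linarith
  intro d hd hge hle x v hv
  have hbound : ∀ s, |-d s| ≤ D := fun s => by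
    rw [abs_neg, abs_of_pos (hd₀.trans_le (hge s))]; exact hle s
  have hbound' : ∀ s, |d₀ + -d s| ≤ D := fun s => by
    rw [abs_le]; constructor <;> linarith [hge s, hle s]
  have h1 := hv.energy_le hS hd hd₀ hge hle hτ.le
  have h2 := (hv.change_semigroup hS hT hST hd.neg hbound).norm_sq_le hT hbound' hτ
  have h3 : ‖T τ x‖ ≤ 1 / 2 * ‖x‖ :=
    (hstab x τ hτ.le).trans (mul_le_mul_of_nonneg_right hτle (norm_nonneg _))
  have h4 : ‖T τ x‖ ^ 2 ≤ (1 / 2 * ‖x‖) ^ 2 := by gcongr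
  set Q := ∫ s in (0 : ℝ)..τ, ‖ContinuousLinearMap.adjoint B (v s)‖ ^ 2
  have h5 : 2 * (D * ‖B‖) ^ 2 * τ * Q = M * (2 * d₀ * Q) := by
    rw [hM]; field_simp
  have h6 : M * (2 * d₀ * Q) ≤ M * (‖x‖ ^ 2 - ‖v τ‖ ^ 2) := by gcongr; linarith
  have h7 : (1 + M) * ‖v τ‖ ^ 2 ≤ (1 / 2 + M) * ‖x‖ ^ 2 := by nlinarith
  refine le_of_sq_le_sq ?_ (by positivity)
  rw [mul_pow, Real.sq_sqrt (by positivity), div_mul_eq_mul_div, le_div_iff₀ hM1]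
  linarith

theorem IsDuhamelSolution.norm_le_of_damping (hS : IsContractionSemigroup S) {d : ℝ → ℝ}
    {d₀ D : ℝ} (hd : Measurable d) (hd₀ : 0 < d₀) (hge : ∀ s, d₀ ≤ d s) (hle : ∀ s, d s ≤ D)
    {x : H} {v : ℝ → H} (hv : IsDuhamelSolution S (dampingOp B) (fun s => -d s) x v) {t : ℝ}
    (ht : 0 ≤ t) : ‖v t‖ ≤ ‖x‖ := by
  have h1 := hv.energy_le hS hd hd₀ hge hle ht
  have h2 : 0 ≤ ∫ s in (0 : ℝ)..t, ‖ContinuousLinearMap.adjoint B (v s)‖ ^ 2 :=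
    intervalIntegral.integral_nonneg ht fun s _ => sq_nonneg _
  refine le_of_sq_le_sq ?_ (norm_nonneg _)
  have : 0 ≤ 2 * d₀ * ∫ s in (0 : ℝ)..t, ‖ContinuousLinearMap.adjoint B (v s)‖ ^ 2 := by
    positivity
  linarith

/-- The factor `ρ⁻¹` pays for the incomplete last step, since `⌊t / τ⌋₊ > t / τ - 1`. -/
theorem pow_floor_le_exp {ρ τ t : ℝ} (hρ : 0 < ρ) (hρ1 : ρ < 1) :
    ρ ^ ⌊t / τ⌋₊ ≤ ρ⁻¹ * Real.exp (-(-Real.log ρ / τ) * t) := by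
  have hlog : Real.log ρ < 0 := Real.log_neg hρ hρ1
  have h1 : ρ ^ ⌊t / τ⌋₊ = Real.exp (⌊t / τ⌋₊ * Real.log ρ) := by
    rw [mul_comm, Real.exp_mul, Real.exp_log hρ, Real.rpow_natCast]
  have h2 : ρ⁻¹ = Real.exp (-Real.log ρ) := by rw [Real.exp_neg, Real.exp_log hρ]
  rw [h1, h2, ← Real.exp_add, Real.exp_le_exp]
  have h3 := (Nat.lt_floor_add_one (t / τ)).le
  have h4 : -(-Real.log ρ / τ) * t = t / τ * Real.log ρ := by ring
  rw [h4]
  nlinarith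

/-- All evolutions with damping coefficient between `d₀` and `D` decay at a uniform rate. -/
theorem exists_uniform_exp_decay (B : U →L[𝕜] H) (hS : IsContractionSemigroup S)
    (hT : IsContractionSemigroup T) {d₀ : ℝ} (hd₀ : 0 < d₀)
    (hST : ∀ x, IsDuhamelSolution T (dampingOp B) (fun _ => d₀) x (fun t => S t x))
    {K₀ β₀ : ℝ} (hβ₀ : 0 < β₀)
    (hstab : ∀ x t, 0 ≤ t → ‖T t x‖ ≤ K₀ * Real.exp (-β₀ * t) * ‖x‖) (D : ℝ) :
    ∃ K > (0 : ℝ), ∃ β > (0 : ℝ), ∀ (d : ℝ → ℝ), Measurable d → (∀ s, d₀ ≤ d s) →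
      (∀ s, d s ≤ D) → ∀ x v, IsDuhamelSolution S (dampingOp B) (fun s => -d s) x v →
      ∀ t, 0 ≤ t → ‖v t‖ ≤ K * Real.exp (-β * t) * ‖x‖ := by
  obtain ⟨τ, hτ, ρ, hρ, hρ1, hcontr⟩ :=
    exists_uniform_contraction B hS hT hd₀ hST hβ₀ hstab D
  refine ⟨ρ⁻¹, inv_pos.2 hρ, -Real.log ρ / τ,
    div_pos (neg_pos.2 (Real.log_neg hρ hρ1)) hτ, ?_⟩
  intro d hd hge hle x v hv t ht
  have hbound : ∀ s, |-d s| ≤ D := fun s => by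
    rw [abs_neg, abs_of_pos (hd₀.trans_le (hge s))]; exact hle s
  have hshift : ∀ r, 0 ≤ r → IsDuhamelSolution S (dampingOp B) (fun s => -d (s + r)) (v r)
      (fun s => v (s + r)) := fun r hr => hv.shift hS hd.neg hbound hr
  have hpow : ∀ n : ℕ, ‖v (n * τ)‖ ≤ ρ ^ n * ‖x‖ := by
    intro n
    induction n with
    | zero => simp [hv.map_zero hS]
    | succ n ih =>
      have h1 := hcontr _ (hd.comp (measurable_add_const (n * τ))) (fun s => hge _)
        (fun s => hle _) _ _ (hshift (n * τ) (by positivity))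
      have h2 : ((n + 1 : ℕ) : ℝ) * τ = τ + n * τ := by push_cast; ring
      rw [h2]
      calc _ ≤ ρ * ‖v (n * τ)‖ := h1
        _ ≤ ρ * (ρ ^ n * ‖x‖) := by gcongr
        _ = _ := by ring
  set n := ⌊t / τ⌋₊ with hn
  have hnt : (n : ℝ) * τ ≤ t := (le_div_iff₀ hτ).1 (Nat.floor_le (div_nonneg ht hτ.le))
  have h1 := (hshift (n * τ) (by positivity)).norm_le_of_damping hS (d := fun s => d (s + n * τ))
    (hd.comp (measurable_add_const (n * τ))) hd₀ (fun s => hge _) (fun s => hle _)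
    (sub_nonneg.2 hnt)
  simp only [sub_add_cancel] at h1
  refine (h1.trans (hpow n)).trans ?_
  gcongr
  exact pow_floor_le_exp hρ hρ1

end Decay

/-! ### Identification of the semigroup of `A`, and the theorem. -/

section Main

open Asymptotics

variable {𝕜 H U : Type*} [RCLike 𝕜]
    [NormedAddCommGroup H] [InnerProductSpace 𝕜 H] [CompleteSpace H]
    [NormedSpace ℝ H]
    [NormedAddCommGroup U] [InnerProductSpace 𝕜 U] [CompleteSpace U]
    {A : H →ₗ.[𝕜] H} {B : U →L[𝕜] H} {S T : ℝ → H →L[𝕜] H}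

/-- Removing the feedback from a generator gives the generator of the perturbed semigroup. -/
theorem IsInfinitesimalGenerator.of_feedbackOp [IsScalarTower ℝ 𝕜 H] {c : ℝ}
    (hg : IsInfinitesimalGenerator (feedbackOp A B c) T) (hT : IsContractionSemigroup T)
    (hS : ∀ x, IsDuhamelSolution T (dampingOp B) (fun _ => c) x (fun t => S t x)) :
    IsInfinitesimalGenerator A S := by
  intro x y
  have h1 : (x, y) ∈ A.graph ↔ (x, y - (c : 𝕜) • dampingOp B x) ∈ (feedbackOp A B c).graph := by
    rw [mem_graph_feedbackOp, sub_add_cancel]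
  rw [h1, hg, tendsto_inv_smul_iff_isLittleO, tendsto_inv_smul_iff_isLittleO]
  -- Since `S h x - T h x = h c BB⋆x + o(h)`, the two difference quotients converge together, on the
  -- same domain.
  have h2 := (hS x).semigroup_isLittleO hT
  have e : ∀ h : ℝ, S h x - x - (h : 𝕜) • y =
      (T h x - x - (h : 𝕜) • (y - (c : 𝕜) • dampingOp B x)) +
        (S h x - T h x - (h * c) • dampingOp B x) := by
    intro h
    rw [RCLike.real_smul_eq_coe_smul (K := 𝕜) (h * c), smul_sub, smul_smul, RCLike.ofReal_mul]
    abel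
  constructor
  · intro h
    exact (h.add h2).congr_left fun h => (e h).symm
  · intro h
    exact (h.sub h2).congr_left fun h => by rw [e h, add_sub_cancel_right]

theorem mild_formula_eq {d d' : ℝ → ℝ} (hdd : ∀ᵐ s, s ∈ Ici (0 : ℝ) → d s = d' s)
    (x : H) (v : ℝ → H) {t : ℝ} (ht : 0 ≤ t) :
    S (t - 0) x - ∫ s in (0 : ℝ)..t, d s • S (t - s) (dampingOp B (v s)) =
      S (max t 0) x + ∫ s in (0 : ℝ)..t, (-d' s) • S (max (t - s) 0) (dampingOp B (v s)) := by
  rw [sub_eq_add_neg, ← intervalIntegral.integral_neg, sub_zero, max_eq_left ht]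
  congr 1
  refine intervalIntegral.integral_congr_ae ?_
  filter_upwards [hdd] with s hs hst
  rw [uIoc_of_le ht] at hst
  rw [hs hst.1.le, neg_smul, max_eq_left (sub_nonneg.2 hst.2)]

/-- Changing `d` on a null set does not affect Duhamel integrals, so the bounds may be taken to hold
everywhere. The upper bound is `max d₀ d₁` because the order of `d₀` and `d₁` is not assumed. -/
theorem exists_measurable_clamp {d : ℝ → ℝ} {d₀ d₁ : ℝ}
    (hd : AEMeasurable d (volume.restrict (Ici 0)))
    (h : ∀ᵐ t ∂(volume.restrict (Ici (0 : ℝ))), d₀ ≤ d t ∧ d t ≤ d₁) :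
    ∃ d' : ℝ → ℝ, Measurable d' ∧ (∀ s, d₀ ≤ d' s) ∧ (∀ s, d' s ≤ max d₀ d₁) ∧
      ∀ᵐ s, s ∈ Ici (0 : ℝ) → d s = d' s := by
  refine ⟨fun s => max d₀ (min (hd.mk d s) d₁),
    measurable_const.max (hd.measurable_mk.min measurable_const), fun s => le_max_left _ _,
    fun s => max_le_max le_rfl (min_le_right _ _), ?_⟩
  rw [← ae_restrict_iff' measurableSet_Ici]
  filter_upwards [h, hd.ae_eq_mk] with s hs he
  rw [← he, min_eq_left hs.2, max_eq_right hs.1]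

end Main

theorem theorem4 {𝕜 H U : Type*} [RCLike 𝕜]
    [NormedAddCommGroup H] [InnerProductSpace 𝕜 H] [CompleteSpace H]
    [NormedSpace ℝ H] [IsScalarTower ℝ 𝕜 H]
    [NormedAddCommGroup U] [InnerProductSpace 𝕜 U] [CompleteSpace U]
    (A : H →ₗ.[𝕜] H) (B : U →L[𝕜] H)
    (hA_dense : Dense (A.domain : Set H))
    (hA_closed : A.IsClosed) (hA_diss : IsDissipativeOp A)
    (hA_adj_closed : A.adjoint.IsClosed) (hA_adj_diss : IsDissipativeOp A.adjoint)
    (d₀ d₁ : ℝ) (hd₀ : 0 < d₀)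
    (hstab : GeneratesExpStableSemigroup (feedbackOp A B d₀)) :
    ∃ K > (0 : ℝ), ∃ β > (0 : ℝ), ∀ d : ℝ → ℝ,
      AEMeasurable d (volume.restrict (Ici 0)) →
      (∀ᵐ t ∂(volume.restrict (Ici (0 : ℝ))), d₀ ≤ d t ∧ d t ≤ d₁) →
      ∀ v₀ : H,
        (∃ v : ℝ → H, IsMildSolution A B d 0 v₀ v) ∧
        ∀ v : ℝ → H, IsMildSolution A B d 0 v₀ v →
          ∀ t : ℝ, 0 ≤ t → ‖v t‖ ≤ K * Real.exp (-β * t) * ‖v₀‖ := by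
  obtain ⟨T₀, hT₀, hgT₀, K₀, -, β₀, hβ₀, hdecay⟩ := hstab
  have hT : IsContractionSemigroup fun t => T₀ (max t 0) :=
    hT₀.isContractionSemigroup hgT₀ hA_dense (hA_diss.feedbackOp hd₀.le)
  have hgT : IsInfinitesimalGenerator (feedbackOp A B d₀) fun t => T₀ (max t 0) :=
    hgT₀.congr fun t ht => by rw [max_eq_left ht]
  obtain ⟨S₀, hS₀, hST₀⟩ := exists_perturbed_semigroup hT (dampingOp B) d₀
  have hgS₀ : IsInfinitesimalGenerator A S₀ := hgT.of_feedbackOp hT hST₀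
  have hS : IsContractionSemigroup fun t => S₀ (max t 0) :=
    hS₀.isContractionSemigroup hgS₀ hA_dense hA_diss
  have hST : ∀ x, IsDuhamelSolution (fun t => T₀ (max t 0)) (dampingOp B) (fun _ => d₀) x
      (fun t => S₀ (max t 0) x) := fun x =>
    (hST₀ x).congr (hS.cont x) fun t ht => by simp only [max_eq_left ht]
  obtain ⟨K, hK, β, hβ, hmain⟩ := exists_uniform_exp_decay B hS hT hd₀ hST hβ₀
    (fun x t ht => by simpa only [max_eq_left ht] using hdecay x t ht) (max d₀ d₁)
  refine ⟨K, hK, β, hβ, fun d hdm hd v₀ => ?_⟩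
  obtain ⟨d', hd'm, hge, hle, hdd⟩ := exists_measurable_clamp hdm hd
  have hbound : ∀ s, |-d' s| ≤ max d₀ d₁ := fun s => by
    rw [abs_neg, abs_of_pos (hd₀.trans_le (hge s))]; exact hle s
  constructor
  · obtain ⟨v, hv⟩ := exists_isDuhamelSolution hS (dampingOp B) hd'm.neg hbound v₀
    refine ⟨v, S₀, hS₀, hgS₀, hv.cont.continuousOn, fun t ht => ?_⟩
    exact (hv.eq t ht).trans (mild_formula_eq (S := S₀) hdd v₀ v ht).symm
  · rintro v ⟨S₁, hS₁, hgS₁, hvc, hv⟩ t ht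
    -- A given mild solution carries its own semigroup, which must first be identified with the
    -- constructed one.
    have hSS : (fun t => S₁ (max t 0)) = fun t => S₀ (max t 0) := funext fun t =>
      hS₁.eq_of_generator hS₀ hgS₁ hgS₀ hA_dense hA_diss (le_max_right t 0)
    have hv' : IsDuhamelSolution (fun t => S₀ (max t 0)) (dampingOp B) (fun s => -d' s) v₀
        (fun t => v (max t 0)) := by
      rw [← hSS]
      refine ⟨hvc.comp_continuous (by fun_prop) fun t => mem_Ici.2 (le_max_right t 0),
        fun t ht => ?_⟩
      refine (congrArg v (max_eq_left ht)).trans ?_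
      rw [hv t ht, mild_formula_eq (S := S₁) hdd v₀ v ht]
      congr 1
      refine intervalIntegral.integral_congr fun s hs => ?_
      rw [uIcc_of_le ht] at hs
      simp only [max_eq_left hs.1]
    simpa only [max_eq_left ht] using hmain d' hd'm hge hle v₀ _ hv' t ht
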